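/- Rings are associative with $1$, and the subring generated by a set always contains $1$. Let $R$ be a finite ring with Jacobson radical $J(R)$, and let $$R/J(R)\;\cong\; M_{n_1}(\mathbb F_{q_1})\times\dots\times M_{n_d}(\mathbb F_{q_d})$$ be its Wedderburn--Artin decomposition, where $\mathbb F_{q_i}$ is a finite field with $q_i$ elements and $n_i\ge 1$. Let $\preceq$ be a partial order on a set $X$ with $n\ge 1$ elements (for instance $X=\{1,\dots,n\}$). Let $$\mathcal A=\mathcal A_n(\preceq,R)=\{A\in M_n(R) : A_{ij}=0 \text{ whenever } i\not\preceq j\}$$ be the incidence ring, whose matrices have rows and columns indexed by $X$. For $m\in\mathbb N=\{0,1,2,\dots\}$ let $\mathrm{Gen}_m(\mathcal A,R)$ be the set of all tuples $(A_1,\dots,A_m)\in\mathcal A^m$ such that $\{A_1,\dots,A_m\}\cup\{rI : r\in R\}$ generates $\mathcal A$ as a ring, and let $\mathrm{mgen}(\mathcal A)$ be the least $m\in\mathbb N$ with $\mathrm{Gen}_m(\mathcal A,R)\ne\varnothing$. Put $$\rho=|\{(i,j): i\preceq j\}|,\qquad c=|\{(i,j): i\prec j \text{ and there is no } k \text{ with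 } i\prec k\prec j\}|.$$ Then for every natural number $m\ge \mathrm{mgen}(\mathcal A)$ we have $n\le q_i^{n_i^2m}$ for all $i$, $n+c\le\rho$, and $$|\mathrm{Gen}_m(\mathcal A,R)| = |J(R)|^{m\rho}\cdot\prod_{i=1}^d \left[\frac{\bigl(q_i^{n_i^2 m}\bigr)!}{\bigl(q_i^{n_i^2 m}-n\bigr)!}\cdot\bigl(q_i^{n_i^2 m}-q_i\bigr)^c\cdot q_i^{\,n_i^2 m(\rho-n-c)}\right],$$ with the convention $0^0=1$. -/

import Mathlib

/-- The incidence ring of the poset `ι` over `R`: the square matrices over `R` indexed by `ι`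
whose `(i, j)` entry vanishes unless `i ≤ j`. -/
def incidenceRing (ι R : Type*) [Fintype ι] [DecidableEq ι] [PartialOrder ι] [Ring R] :
    Subring (Matrix ι ι R) where
  carrier := {A | ∀ i j, ¬ i ≤ j → A i j = 0}
  zero_mem' := fun _ _ _ => rfl
  one_mem' := fun i j h => Matrix.one_apply_ne (fun hij => h hij.le)
  add_mem' := fun {A B} hA hB i j h => by
    simp [Matrix.add_apply, hA i j h, hB i j h]
  neg_mem' := fun {A} hA i j h => by
    simp [Matrix.neg_apply, hA i j h]
  mul_mem' := fun {A B} hA hB i j h => by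
    rw [Matrix.mul_apply]
    refine Finset.sum_eq_zero fun k _ => ?_
    by_cases hik : i ≤ k
    · rw [hB k j (fun hkj => h (hik.trans hkj)), mul_zero]
    · rw [hA i k hik, zero_mul]

/-- The scalar matrices `r • I`, `r ∈ R`, as elements of the incidence ring. -/
def scalarMatrices (ι R : Type*) [Fintype ι] [DecidableEq ι] [PartialOrder ι] [Ring R] :
    Set (incidenceRing ι R) :=
  {B | ∃ r : R, (B : Matrix ι ι R) = Matrix.scalar ι r}

/-- The `m`-tuples of elements of the incidence ring which together with all the scalar matrices
generate it as a (unital) ring. -/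
def genTuples (ι R : Type*) [Fintype ι] [DecidableEq ι] [PartialOrder ι] [Ring R] (m : ℕ) :
    Set (Fin m → incidenceRing ι R) :=
  {A | Subring.closure (Set.range A ∪ scalarMatrices ι R) = ⊤}

/-- The least `m` for which a generating `m`-tuple exists. -/
noncomputable def mgen (ι R : Type*) [Fintype ι] [DecidableEq ι] [PartialOrder ι] [Ring R] : ℕ :=
  sInf {m : ℕ | (genTuples ι R m).Nonempty}

/-- Over a finite ring, `mgen` is attained, i.e. the minimum is over a nonempty set. -/
theorem genTuples_mgen_nonempty (ι R : Type*) [Fintype ι] [DecidableEq ι] [PartialOrder ι]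
    [Ring R] [Finite R] : (genTuples ι R (mgen ι R)).Nonempty := by
  have h : {m : ℕ | (genTuples ι R m).Nonempty}.Nonempty := by
    obtain ⟨m, ⟨e⟩⟩ := Finite.exists_equiv_fin (incidenceRing ι R)
    refine ⟨m, e.symm, ?_⟩
    simp [genTuples]
  exact Nat.sInf_mem h

/-- The number of pairs `(i, j)` with `i ≤ j`. -/
noncomputable def orderSize (ι : Type*) [PartialOrder ι] : ℕ :=
  Nat.card {p : ι × ι // p.1 ≤ p.2}

/-- The number of pairs `(i, j)` such that `j` covers `i`. -/
noncomputable def coverSize (ι : Type*) [PartialOrder ι] : ℕ :=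
  Nat.card {p : ι × ι // p.1 ⋖ p.2}

/-! Reduce to a field, then count there. By Nakayama, generation can be tested modulo `Ring.jacobson
R` (`mem_genFamilies_iff_comp`), so every lift of a generating family generates, which gives the
power of `|J(R)|`. Central idempotents split a product of rings into independent factors
(`mem_genFamilies_pi_iff`). Over a matrix ring, the scalar matrix units extract coefficients, so a
family indexed by `κ` over `Matrix μ μ R` generates exactly when its `κ × μ × μ` coefficients do
over `R` (`mem_genFamilies_matrix_iff`).

Over a field, the strictly upper triangular part `N` is a nilpotent ideal of the incidence ring, and
`N / N²` has the covering pairs as a basis. Only two obstructions remain: two equal diagonal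
characters, or a covering entry proportional to the difference of its two diagonal entries
(`mem_genFamilies_field_iff`). So one chooses `n` distinct vectors for the diagonal, a vector off a
line at each cover, and any vector elsewhere. -/

/-! ### Generated subrings and coordinates on the incidence ring. -/

section Basics

set_option linter.unusedSectionVars false

variable {ι : Type*} [Fintype ι] [DecidableEq ι] [PartialOrder ι]

/-- The subring of `Matrix ι ι R` generated by a family of matrices and all scalar matrices. -/
def genSubring {κ R : Type*} [Ring R] (B : κ → Matrix ι ι R) : Subring (Matrix ι ι R) :=
  Subring.closure (Set.range B ∪ Set.range (Matrix.scalar ι))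

open Classical in
/-- The matrix with prescribed entries at the pairs `i ≤ j` and zeros elsewhere. -/
noncomputable def ofPairs {R : Type*} [Zero R] (g : {p : ι × ι // p.1 ≤ p.2} → R) :
    Matrix ι ι R :=
  Matrix.of fun i j => if h : i ≤ j then g ⟨(i, j), h⟩ else 0

/-- The families `f` of incidence matrices, given by their entries, for which the ring generated
by `f` and the scalar matrices contains all the matrix units of the incidence ring. -/
def genFamilies (ι κ R : Type*) [Fintype ι] [DecidableEq ι] [PartialOrder ι] [Ring R] :
    Set (κ → {p : ι × ι // p.1 ≤ p.2} → R) :=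
  {f | ∀ i j, i ≤ j → Matrix.single i j (1 : R) ∈ genSubring fun a => ofPairs (f a)}

variable {κ R R' : Type*} [Ring R] [Ring R']

theorem ofPairs_apply_of_le (g : {p : ι × ι // p.1 ≤ p.2} → R) {i j : ι} (h : i ≤ j) :
    ofPairs g i j = g ⟨(i, j), h⟩ := by
  simp [ofPairs, h]

theorem ofPairs_apply_of_not_le (g : {p : ι × ι // p.1 ≤ p.2} → R) {i j : ι} (h : ¬ i ≤ j) :
    ofPairs g i j = 0 := by
  simp [ofPairs, h]

theorem ofPairs_mem (g : {p : ι × ι // p.1 ≤ p.2} → R) : ofPairs g ∈ incidenceRing ι R :=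
  fun _ _ h => ofPairs_apply_of_not_le g h

theorem map_ofPairs (φ : R →+* R') (g : {p : ι × ι // p.1 ≤ p.2} → R) :
    (ofPairs g).map φ = ofPairs (φ ∘ g) := by
  ext i j
  by_cases h : i ≤ j
  · simp [ofPairs_apply_of_le _ h]
  · simp [ofPairs_apply_of_not_le _ h]

theorem scalar_mem_genSubring (B : κ → Matrix ι ι R) (r : R) :
    Matrix.scalar ι r ∈ genSubring B :=
  Subring.subset_closure (Or.inr ⟨r, rfl⟩)

theorem mem_genSubring (B : κ → Matrix ι ι R) (a : κ) : B a ∈ genSubring B :=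
  Subring.subset_closure (Or.inl ⟨a, rfl⟩)

theorem genSubring_le {B : κ → Matrix ι ι R} {S : Subring (Matrix ι ι R)}
    (h1 : ∀ a, B a ∈ S) (h2 : ∀ r, Matrix.scalar ι r ∈ S) : genSubring B ≤ S := by
  refine Subring.closure_le.2 ?_
  rintro x (⟨a, rfl⟩ | ⟨r, rfl⟩)
  exacts [h1 a, h2 r]

theorem single_mem_incidenceRing {i j : ι} (h : i ≤ j) (r : R) :
    Matrix.single i j r ∈ incidenceRing ι R := by
  intro u v huv
  refine Matrix.single_apply_of_ne _ _ _ _ _ ?_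
  rintro ⟨rfl, rfl⟩
  exact huv h

theorem scalar_mem_incidenceRing (r : R) : Matrix.scalar ι r ∈ incidenceRing ι R := by
  intro i j h
  rw [Matrix.scalar_apply, Matrix.diagonal_apply_ne _ (fun hij => h hij.le)]

/-- A subring containing the scalar matrices contains the incidence ring as soon as it contains
its matrix units. -/
theorem incidenceRing_le_iff {S : Subring (Matrix ι ι R)} (hS : ∀ r, Matrix.scalar ι r ∈ S) :
    incidenceRing ι R ≤ S ↔ ∀ i j, i ≤ j → Matrix.single i j (1 : R) ∈ S := by
  refine ⟨fun h i j hij => h (single_mem_incidenceRing hij 1), fun h A hA => ?_⟩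
  rw [Matrix.matrix_eq_sum_single A]
  refine sum_mem fun i _ => sum_mem fun j _ => ?_
  by_cases hij : i ≤ j
  · have : Matrix.single i j (A i j) = Matrix.scalar ι (A i j) * Matrix.single i j 1 := by
      rw [Matrix.scalar_apply, ← Matrix.smul_eq_diagonal_mul, Matrix.smul_single, smul_eq_mul,
        mul_one]
    rw [this]
    exact mul_mem (hS _) (h i j hij)
  · rw [hA i j hij, Matrix.single_zero]
    exact zero_mem _

/-- Applying a surjective ring homomorphism entrywise to the generated subring. -/
theorem map_genSubring (φ : R →+* R') (hφ : Function.Surjective φ) (B : κ → Matrix ι ι R) :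
    (genSubring B).map φ.mapMatrix = genSubring fun a => (B a).map φ := by
  have hs (r : R) : (Matrix.scalar ι r).map φ = Matrix.scalar ι (φ r) := by
    simp [Matrix.scalar_apply, Matrix.diagonal_map]
  rw [genSubring, RingHom.map_closure, genSubring, Set.image_union, ← Set.range_comp,
    ← Set.range_comp]
  congr 2
  ext X
  constructor
  · rintro ⟨r, rfl⟩
    exact ⟨φ r, (hs r).symm⟩
  · rintro ⟨r, rfl⟩
    obtain ⟨r, rfl⟩ := hφ r
    exact ⟨r, hs r⟩

theorem genFamilies_comp (φ : R →+* R') (hφ : Function.Surjective φ)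
    {f : κ → {p : ι × ι // p.1 ≤ p.2} → R} (hf : f ∈ genFamilies ι κ R) :
    (fun a => φ ∘ f a) ∈ genFamilies ι κ R' := by
  intro i j hij
  have := (Subring.mem_map (f := φ.mapMatrix)).2 ⟨_, hf i j hij, rfl⟩
  rw [map_genSubring φ hφ] at this
  simpa [map_ofPairs, Matrix.map_single] using this

variable (ι R) in
/-- Incidence matrices correspond to their entries at the pairs `i ≤ j`. -/
noncomputable def incidenceEquiv :
    ({p : ι × ι // p.1 ≤ p.2} → R) ≃ incidenceRing ι R where
  toFun g := ⟨ofPairs g, ofPairs_mem g⟩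
  invFun A p := (A : Matrix ι ι R) p.1.1 p.1.2
  left_inv g := by
    ext p
    exact ofPairs_apply_of_le g p.2
  right_inv A := by
    ext i j
    change ofPairs (fun p => (A : Matrix ι ι R) p.1.1 p.1.2) i j = (A : Matrix ι ι R) i j
    by_cases h : i ≤ j
    · rw [ofPairs_apply_of_le _ h]
    · rw [ofPairs_apply_of_not_le _ h, A.2 i j h]

theorem mem_genTuples_iff {m : ℕ} (A : Fin m → incidenceRing ι R) :
    A ∈ genTuples ι R m ↔ ∀ i j, i ≤ j →
      Matrix.single i j (1 : R) ∈ genSubring fun a => (A a : Matrix ι ι R) := by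
  rw [← incidenceRing_le_iff (scalar_mem_genSubring _)]
  have himg : (Subring.closure (Set.range A ∪ scalarMatrices ι R)).map (incidenceRing ι R).subtype
      = genSubring fun a => (A a : Matrix ι ι R) := by
    rw [RingHom.map_closure, genSubring, Set.image_union, ← Set.range_comp]
    congr 2
    ext X
    constructor
    · rintro ⟨Y, ⟨r, hr⟩, rfl⟩
      exact ⟨r, hr.symm⟩
    · rintro ⟨r, rfl⟩
      exact ⟨⟨_, scalar_mem_incidenceRing r⟩, ⟨r, rfl⟩, rfl⟩
  rw [← himg]
  constructor
  · intro h X hX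
    have h : Subring.closure (Set.range A ∪ scalarMatrices ι R) = ⊤ := h
    rw [h]
    exact ⟨⟨X, hX⟩, trivial, rfl⟩
  · intro h
    refine top_unique fun X _ => ?_
    obtain ⟨Y, hY, hYX⟩ := h X.2
    rwa [← Subtype.ext hYX]

theorem ncard_genTuples (m : ℕ) :
    (genTuples ι R m).ncard = Nat.card (genFamilies ι (Fin m) R) := by
  rw [← Nat.card_coe_set_eq]
  exact (Nat.card_congr (((Equiv.refl (Fin m)).arrowCongr (incidenceEquiv ι R)).subtypeEquiv
    (p := (· ∈ genFamilies ι (Fin m) R)) (q := (· ∈ genTuples ι R m))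
    fun f => (mem_genTuples_iff fun a => incidenceEquiv ι R (f a)).symm)).symm

/-- A minimal generating tuple can be padded with zeros. -/
theorem genTuples_nonempty_of_le [Finite R] {m : ℕ} (h : mgen ι R ≤ m) :
    (genTuples ι R m).Nonempty := by
  obtain ⟨A, hA⟩ := genTuples_mgen_nonempty ι R
  refine ⟨fun a => if h : (a : ℕ) < mgen ι R then A ⟨a, h⟩ else 0, top_unique ?_⟩
  rw [← show _ = _ from hA]
  refine Subring.closure_mono (Set.union_subset_union_left _ ?_)
  rintro _ ⟨a, rfl⟩
  exact ⟨Fin.castLE h a, by simp⟩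

/-- The families over `R` whose images under a surjective homomorphism lie in a given set. -/
theorem card_comp_mem {I : Type*} [Finite I] (φ : R →+* R')
    (hφ : Function.Surjective φ) (T : Set (I → R')) :
    Nat.card {f : I → R | φ ∘ f ∈ T} = Nat.card (RingHom.ker φ) ^ Nat.card I * Nat.card T := by
  -- A set-theoretic section `s` suffices: `f` is determined by `φ ∘ f` and the kernel-valued error
  -- `f - s ∘ φ ∘ f`.
  let s := Function.surjInv hφ
  have hs : ∀ x, φ (s x) = x := Function.surjInv_eq hφ
  have E : {f : I → R | φ ∘ f ∈ T} ≃ (I → RingHom.ker φ) × T :=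
    { toFun f := (fun i => ⟨f.1 i - s (φ (f.1 i)), by simp [RingHom.mem_ker, hs]⟩, ⟨φ ∘ f.1, f.2⟩)
      invFun x := ⟨fun i => x.1 i + s (x.2.1 i), by
        have : φ ∘ (fun i => (x.1 i : R) + s (x.2.1 i)) = x.2.1 := by
          ext i
          simp [hs, (RingHom.mem_ker).1 (x.1 i).2]
        simp [this]⟩
      left_inv f := by ext; simp
      right_inv x := by
        have h (i) : φ (x.1 i) = 0 := (x.1 i).2
        ext i <;> simp [hs, h] }
  rw [Nat.card_congr E, Nat.card_prod, Nat.card_fun]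

end Basics

/-! ### Reduction modulo the radical, to factors, and to matrix coefficients. -/

section Reduction

set_option linter.unusedSectionVars false

variable {ι : Type*} [Fintype ι] [DecidableEq ι] [PartialOrder ι]
variable {κ R R' : Type*} [Ring R] [Ring R']

/-- Generation of the incidence ring can be tested modulo an ideal inside the Jacobson radical. -/
theorem mem_genFamilies_iff_comp [Finite R] (φ : R →+* R') (hφ : Function.Surjective φ)
    (hJ : RingHom.ker φ ≤ Ring.jacobson R) {f : κ → {p : ι × ι // p.1 ≤ p.2} → R} :
    f ∈ genFamilies ι κ R ↔ (fun a => φ ∘ f a) ∈ genFamilies ι κ R' := by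
  refine ⟨genFamilies_comp φ hφ, fun hf => ?_⟩
  have hsmul (r : R) (X : Matrix ι ι R) : r • X = Matrix.scalar ι r * X := by
    rw [Matrix.scalar_apply, ← Matrix.smul_eq_diagonal_mul]
  let B : κ → Matrix ι ι R := fun a => ofPairs (f a)
  -- Containing the scalar matrices makes both subrings left `R`-submodules, so that Nakayama
  -- applies.
  let S : Submodule R (Matrix ι ι R) :=
    { (genSubring B).toAddSubgroup with
      smul_mem' := fun r X hX => by
        rw [hsmul]
        exact mul_mem (scalar_mem_genSubring B r) hX }
  let N : Submodule R (Matrix ι ι R) :=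
    { (incidenceRing ι R).toAddSubgroup with
      smul_mem' := fun r X hX => by
        rw [hsmul]
        exact mul_mem (scalar_mem_incidenceRing r) hX }
  have hBN : genSubring B ≤ incidenceRing ι R :=
    genSubring_le (fun a => ofPairs_mem _) scalar_mem_incidenceRing
  have hunit {i j : ι} (hij : i ≤ j) : Matrix.single i j (1 : R) ∈ N :=
    single_mem_incidenceRing hij 1
  have hexp {A : Matrix ι ι R} : A = ∑ i, ∑ j, A i j • Matrix.single i j (1 : R) := by
    conv_lhs => rw [Matrix.matrix_eq_sum_single A]
    simp [Matrix.smul_single]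
  have hker {D : Matrix ι ι R} (hD : D ∈ N) (h0 : D.map φ = 0) : D ∈ Ring.jacobson R • N := by
    rw [hexp (A := D)]
    refine sum_mem fun i _ => sum_mem fun j _ => ?_
    by_cases hij : i ≤ j
    · exact Submodule.smul_mem_smul (hJ (congrFun (congrFun h0 i) j)) (hunit hij)
    · rw [show D i j = 0 from hD i j hij, zero_smul]
      exact zero_mem _
  have hsingle {i j : ι} (hij : i ≤ j) :
      Matrix.single i j (1 : R) ∈ S ⊔ Ring.jacobson R • N := by
    have h := hf i j hij
    have hB : (fun a => ofPairs (φ ∘ f a)) = fun a => (B a).map φ := by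
      funext a
      rw [map_ofPairs]
    rw [hB, ← map_genSubring φ hφ] at h
    obtain ⟨X, hX, hX'⟩ := Subring.mem_map.1 h
    have hX' : X.map φ = Matrix.single i j 1 := hX'
    rw [← add_sub_cancel X (Matrix.single i j (1 : R))]
    refine Submodule.add_mem_sup hX (hker (sub_mem (hunit hij) (hBN hX)) ?_)
    rw [Matrix.map_sub _ (by simp), hX', Matrix.map_single]
    simp
  have hN : N ≤ S ⊔ Ring.jacobson R • N := by
    intro A hA
    rw [hexp (A := A)]
    refine sum_mem fun i _ => sum_mem fun j _ => ?_
    by_cases hij : i ≤ j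
    · exact Submodule.smul_mem _ _ (hsingle hij)
    · rw [show A i j = 0 from hA i j hij, zero_smul]
      exact zero_mem _
  -- Modulo `S`, the inclusion `hN` says that the image of `N` lies in the radical times itself;
  -- finiteness supplies finite generation.
  have h0 : N.map S.mkQ = ⊥ := by
    have : Finite (Matrix ι ι R) := inferInstanceAs (Finite (ι → ι → R))
    refine Submodule.FG.eq_bot_of_le_jacobson_smul (IsNoetherian.noetherian _) ?_
    refine (Submodule.map_mono hN).trans ?_
    rw [Submodule.map_sup, Submodule.map_smul'']
    simp
  intro i j hij
  have := (Submodule.Quotient.mk_eq_zero S).1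
    ((Submodule.eq_bot_iff _).1 h0 _ (Submodule.mem_map_of_mem (f := S.mkQ) (hunit hij)))
  exact this

/-- Each of the `Nat.card κ * orderSize ι` entries is lifted independently, and every lift of a
generating family generates. -/
theorem card_genFamilies_of_surjective [Finite R] [Finite κ] (φ : R →+* R')
    (hφ : Function.Surjective φ) (hJ : RingHom.ker φ ≤ Ring.jacobson R) :
    Nat.card (genFamilies ι κ R) =
      Nat.card (RingHom.ker φ) ^ (Nat.card κ * orderSize ι) * Nat.card (genFamilies ι κ R') := by
  let T : Set (κ × {p : ι × ι // p.1 ≤ p.2} → R') := {g | Function.curry g ∈ genFamilies ι κ R'}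
  have h1 : Nat.card (genFamilies ι κ R) =
      Nat.card {f : κ × {p : ι × ι // p.1 ≤ p.2} → R | φ ∘ f ∈ T} := by
    refine (Nat.card_congr ((Equiv.curry _ _ _).subtypeEquiv fun f => ?_)).symm
    exact (mem_genFamilies_iff_comp φ hφ hJ (f := Function.curry f)).symm
  have h2 : Nat.card T = Nat.card (genFamilies ι κ R') :=
    Nat.card_congr ((Equiv.curry _ _ _).subtypeEquiv fun f => Iff.rfl)
  rw [h1, card_comp_mem φ hφ, h2, Nat.card_prod, orderSize]

/-- Generation over a finite product of rings is componentwise. -/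
theorem mem_genFamilies_pi_iff {δ : Type*} [Fintype δ] [DecidableEq δ] {Q : δ → Type*}
    [∀ i, Ring (Q i)] {f : κ → {p : ι × ι // p.1 ≤ p.2} → ∀ i, Q i} :
    f ∈ genFamilies ι κ (∀ i, Q i) ↔ ∀ i, (fun a p => f a p i) ∈ genFamilies ι κ (Q i) := by
  constructor
  · intro h i
    exact genFamilies_comp (Pi.evalRingHom Q i) (Function.surjective_eval i) h
  · intro h u v huv
    -- Multiplying any lift `X` of the unit over `Q i` by the scalar matrix of the `i`-th idempotent
    -- kills its uncontrolled components.
    have key (i : δ) : Matrix.single u v (Pi.single i 1 : ∀ i, Q i) ∈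
        genSubring fun a => ofPairs (f a) := by
      have hi := h i u v huv
      have hB : (fun a => ofPairs (fun p => f a p i)) =
          fun a => (ofPairs (f a)).map (Pi.evalRingHom Q i) := by
        funext a
        rw [map_ofPairs]
        rfl
      rw [hB, ← map_genSubring _ (Function.surjective_eval i)] at hi
      obtain ⟨X, hX, hX'⟩ := Subring.mem_map.1 hi
      have hX' : X.map (Pi.evalRingHom Q i) = Matrix.single u v 1 := hX'
      have := mul_mem (scalar_mem_genSubring (fun a => ofPairs (f a)) (Pi.single i 1)) hX
      convert this using 1
      rw [Matrix.scalar_apply, ← Matrix.smul_eq_diagonal_mul]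
      ext s t l
      have hst := congrFun (congrFun hX' s) t
      simp only [Matrix.map_apply, Pi.evalRingHom_apply] at hst
      rcases eq_or_ne l i with rfl | hl
      · simp only [Matrix.smul_apply, smul_eq_mul, Pi.mul_apply, Pi.single_eq_same, one_mul, hst]
        by_cases hc : u = s ∧ v = t <;> simp [hc]
      · by_cases hc : u = s ∧ v = t <;> simp [hc, hl]
    have hsum : Matrix.single u v (1 : ∀ i, Q i) =
        ∑ i, Matrix.single u v (Pi.single i 1 : ∀ i, Q i) := by
      have h1 : (1 : ∀ i, Q i) = ∑ i, Pi.single i 1 := (Finset.univ_sum_single _).symm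
      rw [h1]
      exact map_sum (Matrix.singleAddMonoidHom u v) _ _
    rw [hsum]
    exact sum_mem fun i _ => key i

theorem card_genFamilies_pi {δ : Type*} [Fintype δ] [DecidableEq δ] (Q : δ → Type*)
    [∀ i, Ring (Q i)] :
    Nat.card (genFamilies ι κ (∀ i, Q i)) = ∏ i, Nat.card (genFamilies ι κ (Q i)) := by
  rw [← Nat.card_pi]
  exact Nat.card_congr
    { toFun f i := ⟨fun a p => f.1 a p i, mem_genFamilies_pi_iff.1 f.2 i⟩
      invFun g := ⟨fun a p i => (g i).1 a p, mem_genFamilies_pi_iff.2 fun i => (g i).2⟩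
      left_inv _ := rfl
      right_inv _ := rfl }

/-- Generation over a matrix ring amounts to generation by all the matrix coefficients. -/
theorem mem_genFamilies_matrix_iff {μ : Type*} [Fintype μ] [DecidableEq μ] [Nonempty μ]
    {f : κ → {p : ι × ι // p.1 ≤ p.2} → Matrix μ μ R} :
    f ∈ genFamilies ι κ (Matrix μ μ R) ↔
      (fun (x : κ × μ × μ) p => f x.1 p x.2.1 x.2.2) ∈ genFamilies ι (κ × μ × μ) R := by
  let B : κ × μ × μ → Matrix ι ι R := fun x => ofPairs fun p => f x.1 p x.2.1 x.2.2
  let C : κ → Matrix ι ι (Matrix μ μ R) := fun a => ofPairs (f a)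
  have hBC (a : κ) (s t : μ) (i j : ι) : C a i j s t = B (a, s, t) i j := by
    by_cases h : i ≤ j
    · simp only [C, B, ofPairs_apply_of_le _ h]
    · simp only [C, B, ofPairs_apply_of_not_le _ h, Matrix.zero_apply]
  constructor
  · intro hf i j hij
    -- Matrices all of whose coefficient matrices are generated by `B`. Closure under products is
    -- `(XY)_{st} = ∑ w, X_{sw} Y_{wt}`.
    let T : Subring (Matrix ι ι (Matrix μ μ R)) :=
      { carrier := {X | ∀ s t, (Matrix.of fun i j => X i j s t) ∈ genSubring B}
        zero_mem' := fun s t => zero_mem (genSubring B)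
        one_mem' := fun s t => by
          have : (Matrix.of fun i j => (1 : Matrix ι ι (Matrix μ μ R)) i j s t) =
              Matrix.scalar ι ((1 : Matrix μ μ R) s t) := by
            ext i j
            by_cases h : i = j <;> simp [Matrix.scalar_apply, h]
          rw [this]
          exact scalar_mem_genSubring B _
        add_mem' := fun hX hY s t => add_mem (hX s t) (hY s t)
        neg_mem' := fun hX s t => neg_mem (hX s t)
        mul_mem' := fun {X Y} hX hY s t => by
          have : (Matrix.of fun i j => (X * Y) i j s t) =
              ∑ w, (Matrix.of fun i j => X i j s w) * (Matrix.of fun i j => Y i j w t) := by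
            ext i j
            simp only [Matrix.of_apply, Matrix.mul_apply, Matrix.sum_apply]
            exact Finset.sum_comm
          rw [this]
          exact sum_mem fun w _ => mul_mem (hX s w) (hY w t) }
    have hT : genSubring C ≤ T := by
      refine genSubring_le (fun a s t => ?_) fun r s t => ?_
      · rw [show (Matrix.of fun i j => C a i j s t) = B (a, s, t) from
          Matrix.ext fun i j => hBC a s t i j]
        exact mem_genSubring B _
      · rw [show (Matrix.of fun i j => Matrix.scalar ι r i j s t) = Matrix.scalar ι (r s t) from ?_]
        · exact scalar_mem_genSubring B _
        · ext i j
          by_cases h : i = j <;> simp [Matrix.scalar_apply, h]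
    obtain ⟨s⟩ := ‹Nonempty μ›
    have := hT (hf i j hij) s s
    convert this using 1
    ext u v
    by_cases hc : i = u ∧ j = v <;> simp [Matrix.single_apply, hc]
  · intro hf i j hij
    let H : Matrix ι ι R →+* Matrix ι ι (Matrix μ μ R) := (Matrix.scalar μ).mapMatrix
    have hH : genSubring B ≤ (genSubring C).comap H := by
      refine genSubring_le (fun x => ?_) fun r => ?_
      · obtain ⟨a, s, t⟩ := x
        -- In each entry, `∑ w, E_{ws} M E_{tw}` is the scalar matrix of the coefficient `M s t`.
        have : H (B (a, s, t)) = ∑ w, Matrix.scalar ι (Matrix.single w s (1 : R)) * C a *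
            Matrix.scalar ι (Matrix.single t w (1 : R)) := by
          ext i j : 1
          simp only [Matrix.sum_apply, Matrix.scalar_apply, Matrix.diagonal_mul,
            Matrix.mul_diagonal]
          ext u v
          rw [Matrix.sum_apply]
          simp only [Matrix.single_mul_mul_single, hBC, one_mul, mul_one]
          simp [H, Matrix.single_apply, Matrix.diagonal_apply, Matrix.scalar_apply, ite_and]
        rw [Subring.mem_comap, this]
        exact sum_mem fun w _ => mul_mem (mul_mem (scalar_mem_genSubring C _)
          (mem_genSubring C a)) (scalar_mem_genSubring C _)
      · have : H (Matrix.scalar ι r) = Matrix.scalar ι (Matrix.scalar μ r) := by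
          simp [H, Matrix.scalar_apply, Matrix.diagonal_map]
        rw [Subring.mem_comap, this]
        exact scalar_mem_genSubring C _
    have := hH (hf i j hij)
    rwa [Subring.mem_comap, RingHom.mapMatrix_apply, Matrix.map_single, map_one] at this

theorem card_genFamilies_matrix {μ : Type*} [Fintype μ] [DecidableEq μ] [Nonempty μ] :
    Nat.card (genFamilies ι κ (Matrix μ μ R)) = Nat.card (genFamilies ι (κ × μ × μ) R) :=
  Nat.card_congr
    { toFun f := ⟨fun x p => f.1 x.1 p x.2.1 x.2.2, mem_genFamilies_matrix_iff.1 f.2⟩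
      invFun g := ⟨fun a p => Matrix.of fun s t => g.1 (a, s, t) p,
        mem_genFamilies_matrix_iff.2 g.2⟩
      left_inv _ := rfl
      right_inv _ := rfl }

end Reduction

/-! ### The generation criterion over a field. -/

section OverField

set_option linter.unusedSectionVars false

variable {ι : Type*} [Fintype ι] [DecidableEq ι] [PartialOrder ι]

theorem incidence_mul_diag {R : Type*} [Ring R] {X Y : Matrix ι ι R}
    (hX : X ∈ incidenceRing ι R) (hY : Y ∈ incidenceRing ι R) (u : ι) :
    (X * Y) u u = X u u * Y u u := by
  rw [Matrix.mul_apply]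
  refine Finset.sum_eq_single u (fun w _ hw => ?_) (by simp)
  by_cases h : u ≤ w
  · rw [hY w u fun h' => hw (le_antisymm h' h), mul_zero]
  · rw [hX u w h, zero_mul]

/-- No index lies strictly between `u` and `v`, so the entry behaves as a derivation between the two
diagonal characters. -/
theorem incidence_mul_covBy {R : Type*} [Ring R] {X Y : Matrix ι ι R}
    (hX : X ∈ incidenceRing ι R) (hY : Y ∈ incidenceRing ι R) {u v : ι} (huv : u ⋖ v) :
    (X * Y) u v = X u u * Y u v + X u v * Y v v := by
  rw [Matrix.mul_apply, ← Finset.sum_pair huv.lt.ne (f := fun w => X u w * Y w v)]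
  refine (Finset.sum_subset (Finset.subset_univ _) fun w _ hw => ?_).symm
  simp only [Finset.mem_insert, Finset.mem_singleton, not_or] at hw
  by_cases h : u ≤ w
  · rw [hY w v fun h' => huv.2 (lt_of_le_of_ne h (Ne.symm hw.1)) (lt_of_le_of_ne h' hw.2),
      mul_zero]
  · rw [hX u w h, zero_mul]

variable {κ K : Type*} [Field K]

variable (ι K) in
/-- The strictly upper triangular incidence matrices. -/
def strictIncidence : Submodule K (Matrix ι ι K) where
  carrier := {X | ∀ u v, ¬ u < v → X u v = 0}
  zero_mem' := fun _ _ _ => rfl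
  add_mem' := fun {X Y} hX hY u v h => by simp [hX u v h, hY u v h]
  smul_mem' := fun r X hX u v h => by simp [hX u v h]

/-- Each strict factor moves the row index strictly up, which shrinks `Set.Ioi`; this yields
nilpotence. -/
theorem strictIncidence_pow_apply (k : ℕ) {X : Matrix ι ι K} (hX : X ∈ strictIncidence ι K ^ k)
    (u v : ι) (h : (Set.Ioi u).ncard < k) : X u v = 0 := by
  let M (k : ℕ) : Submodule K (Matrix ι ι K) :=
    { carrier := {X | ∀ u v, (Set.Ioi u).ncard < k → X u v = 0}
      zero_mem' := fun _ _ _ => rfl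
      add_mem' := fun {X Y} hX hY u v h => by simp [hX u v h, hY u v h]
      smul_mem' := fun r X hX u v h => by simp [hX u v h] }
  have key : strictIncidence ι K ^ k ≤ M k := by
    clear h hX
    induction k with
    | zero => exact fun X _ u v h => absurd h (Nat.not_lt_zero _)
    | succ k ih =>
      rw [pow_succ']
      refine Submodule.mul_le.2 fun X hX Y hY u v huv => ?_
      rw [Matrix.mul_apply]
      refine Finset.sum_eq_zero fun w _ => ?_
      by_cases h : u < w
      · have hlt : (Set.Ioi w).ncard < (Set.Ioi u).ncard :=
          Set.ncard_lt_ncard (Set.Ioi_ssubset_Ioi h) (Set.toFinite _)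
        rw [ih hY w v (by omega), mul_zero]
      · rw [hX u w h, zero_mul]
  exact key hX u v h

/-- A subalgebra containing the strictly upper triangular matrices modulo their square contains
all of them. -/
theorem strictIncidence_le_of_le_sup {S : Submodule K (Matrix ι ι K)} (hS : S * S ≤ S)
    (h : strictIncidence ι K ≤
      S ⊓ strictIncidence ι K ⊔ strictIncidence ι K * strictIncidence ι K) :
    strictIncidence ι K ≤ S := by
  set N := strictIncidence ι K with hN
  -- Each layer `N ^ (k + 1)` is covered by `S` modulo the next: multiply the previous layer by the
  -- hypothesis on `N`.
  have step (k : ℕ) : N ^ (k + 1) ≤ S ⊓ N ^ (k + 1) ⊔ N ^ (k + 2) := by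
    induction k with
    | zero => simpa [pow_succ] using h
    | succ k ih =>
      calc N ^ (k + 2) = N ^ (k + 1) * N := pow_succ _ _
        _ ≤ (S ⊓ N ^ (k + 1) ⊔ N ^ (k + 2)) * N := mul_le_mul_left ih _
        _ = (S ⊓ N ^ (k + 1)) * N ⊔ N ^ (k + 3) := by rw [Submodule.sup_mul, ← pow_succ]
        _ ≤ S ⊓ N ^ (k + 2) ⊔ N ^ (k + 3) := sup_le ?_ le_sup_right
      calc (S ⊓ N ^ (k + 1)) * N
          ≤ (S ⊓ N ^ (k + 1)) * (S ⊓ N ⊔ N * N) := mul_le_mul_right h _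
        _ = (S ⊓ N ^ (k + 1)) * (S ⊓ N) ⊔ (S ⊓ N ^ (k + 1)) * (N * N) := Submodule.mul_sup _ _ _
        _ ≤ S ⊓ N ^ (k + 2) ⊔ N ^ (k + 3) := sup_le_sup ?_ ?_
      · refine le_inf ((mul_le_mul' inf_le_left inf_le_left).trans hS) ?_
        rw [pow_succ N (k + 1)]
        exact mul_le_mul' inf_le_right inf_le_right
      · rw [pow_succ N (k + 2), pow_succ N (k + 1), mul_assoc]
        exact mul_le_mul' inf_le_right le_rfl
  have all (k : ℕ) : N ≤ S ⊔ N ^ (k + 1) := by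
    induction k with
    | zero => simp
    | succ k ih =>
      exact ih.trans (sup_le le_sup_left ((step k).trans (sup_le_sup inf_le_left le_rfl)))
  have hbot : N ^ (Nat.card ι + 1) = ⊥ := by
    refine (Submodule.eq_bot_iff _).2 fun X hX => ?_
    ext u v
    refine strictIncidence_pow_apply _ hX u v ?_
    have := Set.ncard_le_card (Set.Ioi u)
    omega
  exact (all (Nat.card ι)).trans (by rw [hbot, sup_bot_eq])

theorem genSubring_ofPairs_le {R : Type*} [Ring R] (f : κ → {p : ι × ι // p.1 ≤ p.2} → R) :
    (genSubring fun a => ofPairs (f a)) ≤ incidenceRing ι R :=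
  genSubring_le (fun _ => ofPairs_mem _) scalar_mem_incidenceRing

theorem scalar_mul_apply {R : Type*} [Ring R] (r : R) (X : Matrix ι ι R) (u v : ι) :
    (Matrix.scalar ι r * X) u v = r * X u v := by
  rw [Matrix.scalar_apply, Matrix.diagonal_mul]

/-- Necessity of the conditions on the diagonal entries and on the entries at covering pairs. -/
theorem separates_of_mem_genFamilies {f : κ → {p : ι × ι // p.1 ≤ p.2} → K}
    (hf : f ∈ genFamilies ι κ K) :
    (Function.Injective fun u a => f a ⟨(u, u), le_rfl⟩) ∧
      ∀ u v (h : u ⋖ v) (t : K), (fun a => f a ⟨(u, v), h.le⟩) ≠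
        t • ((fun a => f a ⟨(u, u), le_rfl⟩) - fun a => f a ⟨(v, v), le_rfl⟩) := by
  constructor
  · intro u v huv
    by_contra hne
    let T : Subring (Matrix ι ι K) :=
      { carrier := {X | X ∈ incidenceRing ι K ∧ X u u = X v v}
        zero_mem' := ⟨zero_mem _, rfl⟩
        one_mem' := ⟨one_mem _, by simp⟩
        add_mem' := fun hX hY => ⟨add_mem hX.1 hY.1, by simp [hX.2, hY.2]⟩
        neg_mem' := fun hX => ⟨neg_mem hX.1, by simp [hX.2]⟩
        mul_mem' := fun hX hY => ⟨mul_mem hX.1 hY.1, by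
          simp [incidence_mul_diag hX.1 hY.1, hX.2, hY.2]⟩ }
    have hT : (genSubring fun a => ofPairs (f a)) ≤ T := by
      refine genSubring_le (fun a => ⟨ofPairs_mem _, ?_⟩) fun r => ⟨scalar_mem_incidenceRing r, ?_⟩
      · rw [ofPairs_apply_of_le _ le_rfl, ofPairs_apply_of_le _ le_rfl]
        exact congrFun huv a
      · simp [Matrix.scalar_apply]
    have := (hT (hf u u le_rfl)).2
    simp [hne] at this
  · intro u v huv t ht
    -- A proportionality relation survives products, since `x t(y - y') + t(x - x') y' = t(xy -
    -- x'y')`. The unit at `(u, v)` violates it.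
    let T : Subring (Matrix ι ι K) :=
      { carrier := {X | X ∈ incidenceRing ι K ∧ X u v = t * (X u u - X v v)}
        zero_mem' := ⟨zero_mem _, by simp⟩
        one_mem' := ⟨one_mem _, by simp [huv.lt.ne]⟩
        add_mem' := fun hX hY => ⟨add_mem hX.1 hY.1, by
          simp only [Matrix.add_apply, hX.2, hY.2]; ring⟩
        neg_mem' := fun hX => ⟨neg_mem hX.1, by simp only [Matrix.neg_apply, hX.2]; ring⟩
        mul_mem' := fun hX hY => ⟨mul_mem hX.1 hY.1, by
          simp only [incidence_mul_diag hX.1 hY.1, incidence_mul_covBy hX.1 hY.1 huv, hX.2, hY.2]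
          ring⟩ }
    have hT : (genSubring fun a => ofPairs (f a)) ≤ T := by
      refine genSubring_le (fun a => ⟨ofPairs_mem _, ?_⟩) fun r => ⟨scalar_mem_incidenceRing r, ?_⟩
      · rw [ofPairs_apply_of_le _ le_rfl, ofPairs_apply_of_le _ le_rfl,
          ofPairs_apply_of_le _ huv.le]
        exact congrFun ht a
      · simp [Matrix.scalar_apply, huv.lt.ne]
    have := (hT (hf u v huv.le)).2
    simp [huv.lt.ne, huv.lt.ne'] at this

/-! ### Separation of characters and covers forces generation. -/

section Sufficiency

variable {G : Subring (Matrix ι ι K)}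

/-- If the diagonal characters of a ring of incidence matrices are pairwise separated, the ring
contains, for each index, a matrix whose diagonal is the corresponding basis vector. -/
theorem exists_mem_diag_eq_single (hG : G ≤ incidenceRing ι K)
    (hs : ∀ r, Matrix.scalar ι r ∈ G) (hsep : ∀ u v, u ≠ v → ∃ X ∈ G, X u u ≠ X v v) (u : ι) :
    ∃ X ∈ G, X u u = 1 ∧ ∀ v, v ≠ u → X v v = 0 := by
  -- Lagrange interpolation: each `w` contributes a factor `(Y - Y w w) / (Y u u - Y w w)`.
  have key (s : Finset ι) (hu : u ∉ s) : ∃ X ∈ G, X u u = 1 ∧ ∀ v ∈ s, X v v = 0 := by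
    induction s using Finset.induction_on with
    | empty => exact ⟨1, one_mem _, by simp, by simp⟩
    | insert w s _ ih =>
      simp only [Finset.mem_insert, not_or] at hu
      obtain ⟨X, hX, hXu, hXs⟩ := ih hu.2
      obtain ⟨Y, hY, hne⟩ := hsep u w hu.1
      have hZ : Matrix.scalar ι (Y u u - Y w w)⁻¹ * (Y - Matrix.scalar ι (Y w w)) ∈ G :=
        mul_mem (hs _) (sub_mem hY (hs _))
      refine ⟨_, mul_mem hZ hX, ?_, fun v hv => ?_⟩
      · rw [incidence_mul_diag (hG hZ) (hG hX), scalar_mul_apply, hXu]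
        simp [Matrix.scalar_apply, sub_ne_zero.2 hne]
      · rw [incidence_mul_diag (hG hZ) (hG hX), scalar_mul_apply]
        rcases Finset.mem_insert.1 hv with rfl | hv
        · simp [Matrix.scalar_apply]
        · simp [hXs v hv]
  obtain ⟨X, hX, h1, h0⟩ := key (Finset.univ.erase u) (by simp)
  exact ⟨X, hX, h1, fun v hv => h0 v (by simp [hv])⟩

/-- Under the conditions on diagonals and on covering pairs, the ring contains each matrix unit at
a covering pair up to a matrix vanishing on the diagonal and at all covering pairs. -/
theorem exists_mem_eq_single_covBy (hG : G ≤ incidenceRing ι K)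
    (hs : ∀ r, Matrix.scalar ι r ∈ G) (hsep : ∀ u v, u ≠ v → ∃ X ∈ G, X u u ≠ X v v)
    {i j : ι} (hij : i ⋖ j) (hcov : ∀ t : K, ∃ X ∈ G, X i j ≠ t * (X i i - X j j)) :
    ∃ Y ∈ G, (∀ u, Y u u = 0) ∧ ∀ u v, u ⋖ v → Y u v = Matrix.single i j (1 : K) u v := by
  obtain ⟨P, hP, hPi, hP0⟩ := exists_mem_diag_eq_single hG hs hsep i
  obtain ⟨Q, hQ, hQj, hQ0⟩ := exists_mem_diag_eq_single hG hs hsep j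
  have hPj : P j j = 0 := hP0 j hij.lt.ne'
  -- The constant `P i j` is chosen so that clearing the diagonal entries of `A` at `i` and `j` with
  -- `P` leaves a nonzero `(i, j)` entry. The product `P * X * Q` then isolates that entry among the
  -- covers.
  obtain ⟨A, hA, hne⟩ := hcov (P i j)
  let X := A - Matrix.scalar ι (A j j) - Matrix.scalar ι (A i i - A j j) * P
  have hX : X ∈ G := sub_mem (sub_mem hA (hs _)) (mul_mem (hs _) hP)
  have hXi : X i i = 0 := by simp [X, Matrix.scalar_apply, hPi]
  have hXj : X j j = 0 := by simp [X, Matrix.scalar_apply, hPj]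
  have hXij : X i j ≠ 0 := by
    have : X i j = A i j - P i j * (A i i - A j j) := by
      simp [X, Matrix.scalar_apply, hij.lt.ne, mul_comm]
    rw [this]
    exact sub_ne_zero.2 hne
  have hPX := mul_mem hP hX
  refine ⟨Matrix.scalar ι (X i j)⁻¹ * (P * X * Q), mul_mem (hs _) (mul_mem hPX hQ),
    fun u => ?_, fun u v huv => ?_⟩
  · rw [scalar_mul_apply, incidence_mul_diag (hG hPX) (hG hQ), incidence_mul_diag (hG hP) (hG hX)]
    by_cases hu : u = i
    · simp [hu, hXi]
    · simp [hP0 u hu]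
  · rw [scalar_mul_apply, incidence_mul_covBy (hG hPX) (hG hQ) huv,
      incidence_mul_diag (hG hP) (hG hX), incidence_mul_covBy (hG hP) (hG hX) huv]
    by_cases hu : u = i
    · subst hu
      by_cases hv : v = j
      · subst hv
        simp [hXi, hXj, hPi, hQj, hXij]
      · simp [hXi, hQ0 v hv, Ne.symm hv]
    · by_cases hv : v = j
      · subst hv
        simp [hP0 u hu, hXj, Ne.symm hu]
      · simp [hP0 u hu, hQ0 v hv, Ne.symm hu]

/-- The approximate covering units span `N` modulo `N²`, so nilpotence puts all of `N` in `G`. A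
matrix with diagonal `e_i` then differs from the diagonal unit only by an element of `N`. -/
theorem incidenceRing_le_of_separates (hG : G ≤ incidenceRing ι K)
    (hs : ∀ r, Matrix.scalar ι r ∈ G) (hsep : ∀ u v, u ≠ v → ∃ X ∈ G, X u u ≠ X v v)
    (hcov : ∀ i j, i ⋖ j → ∀ t : K, ∃ X ∈ G, X i j ≠ t * (X i i - X j j)) :
    incidenceRing ι K ≤ G := by
  let S : Submodule K (Matrix ι ι K) :=
    { G.toAddSubgroup with
      smul_mem' := fun r X hX => by
        have : r • X = Matrix.scalar ι r * X := by
          rw [Matrix.scalar_apply, ← Matrix.smul_eq_diagonal_mul]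
        rw [this]
        exact mul_mem (hs r) hX }
  have hSS : S * S ≤ S := Submodule.mul_le.2 fun X hX Y hY => mul_mem (S := Subring _) hX hY
  have hunit {i j : ι} (h : i < j) (r : K) : Matrix.single i j r ∈ strictIncidence ι K := by
    intro u v huv
    refine Matrix.single_apply_of_ne _ _ _ _ _ ?_
    rintro ⟨rfl, rfl⟩
    exact huv h
  have hstrict {X : Matrix ι ι K} (hX : X ∈ incidenceRing ι K) (h0 : ∀ u, X u u = 0) :
      X ∈ strictIncidence ι K := by
    intro u v huv
    rcases eq_or_ne u v with rfl | hne
    · exact h0 u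
    · exact hX u v fun h => huv (lt_of_le_of_ne h hne)
  have hsq {X : Matrix ι ι K} (hX : X ∈ strictIncidence ι K) (h0 : ∀ u v, u ⋖ v → X u v = 0) :
      X ∈ strictIncidence ι K * strictIncidence ι K := by
    rw [Matrix.matrix_eq_sum_single X]
    refine sum_mem fun i _ => sum_mem fun j _ => ?_
    by_cases hij : i < j
    · by_cases hc : i ⋖ j
      · rw [h0 i j hc, Matrix.single_zero]
        exact zero_mem _
      -- An intermediate `w` factors the unit as `E_{iw} E_{wj}`.
      · obtain ⟨w, h1, h2⟩ := (not_covBy_iff hij).1 hc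
        rw [← one_mul (X i j), ← Matrix.single_mul_single_same (j := w)]
        exact Submodule.mul_mem_mul (hunit h1 _) (hunit h2 _)
    · rw [hX i j hij, Matrix.single_zero]
      exact zero_mem _
  have hN : strictIncidence ι K ≤ S := by
    refine strictIncidence_le_of_le_sup hSS fun X hX => ?_
    rw [Matrix.matrix_eq_sum_single X]
    refine sum_mem fun i _ => sum_mem fun j _ => ?_
    by_cases hij : i < j
    · by_cases hc : i ⋖ j
      · obtain ⟨Y, hY, hY0, hYc⟩ := exists_mem_eq_single_covBy hG hs hsep hc (hcov i j hc)
        have hYN := hstrict (hG hY) hY0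
        have h1 : Matrix.single i j (X i j) = X i j • Matrix.single i j (1 : K) := by
          simp [Matrix.smul_single]
        rw [h1]
        refine Submodule.smul_mem _ _ ?_
        rw [← add_sub_cancel Y (Matrix.single i j (1 : K))]
        refine Submodule.add_mem_sup ⟨hY, hYN⟩ (hsq (sub_mem (hunit hij 1) hYN) fun u v huv => ?_)
        rw [Matrix.sub_apply, hYc u v huv, sub_self]
      · refine Submodule.mem_sup_right (hsq (hunit hij _) fun u v huv => ?_)
        refine Matrix.single_apply_of_ne _ _ _ _ _ ?_
        rintro ⟨rfl, rfl⟩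
        exact hc huv
    · rw [hX i j hij, Matrix.single_zero]
      exact zero_mem _
  refine (incidenceRing_le_iff hs).2 fun i j hij => ?_
  rcases hij.eq_or_lt with rfl | hij
  · obtain ⟨P, hP, hPi, hP0⟩ := exists_mem_diag_eq_single hG hs hsep i
    rw [← add_sub_cancel P (Matrix.single i i (1 : K))]
    refine add_mem hP (hN (hstrict (sub_mem (single_mem_incidenceRing le_rfl 1) (hG hP))
      fun u => ?_))
    rcases eq_or_ne u i with rfl | hu
    · simp [hPi]
    · simp [hP0 u hu, Ne.symm hu]
  · exact hN (hunit hij 1)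

end Sufficiency

/-- Generators of an incidence algebra over a field: the diagonals are distinct, and at each
covering pair the entries are not proportional to the difference of the two diagonals. -/
theorem mem_genFamilies_field_iff {f : κ → {p : ι × ι // p.1 ≤ p.2} → K} :
    f ∈ genFamilies ι κ K ↔
    (Function.Injective fun u a => f a ⟨(u, u), le_rfl⟩) ∧
      ∀ u v (h : u ⋖ v) (t : K), (fun a => f a ⟨(u, v), h.le⟩) ≠
        t • ((fun a => f a ⟨(u, u), le_rfl⟩) - fun a => f a ⟨(v, v), le_rfl⟩) := by
  refine ⟨separates_of_mem_genFamilies, fun ⟨h1, h2⟩ => ?_⟩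
  refine (incidenceRing_le_iff (scalar_mem_genSubring _)).1
    (incidenceRing_le_of_separates (genSubring_ofPairs_le f) (scalar_mem_genSubring _)
      (fun u v huv => ?_) fun u v huv t => ?_)
  · obtain ⟨a, ha⟩ := Function.ne_iff.1 (h1.ne huv)
    refine ⟨_, mem_genSubring _ a, ?_⟩
    rwa [ofPairs_apply_of_le _ le_rfl, ofPairs_apply_of_le _ le_rfl]
  · obtain ⟨a, ha⟩ := Function.ne_iff.1 (h2 u v huv t)
    refine ⟨_, mem_genSubring _ a, ?_⟩
    rwa [ofPairs_apply_of_le _ le_rfl, ofPairs_apply_of_le _ le_rfl,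
      ofPairs_apply_of_le _ huv.le]

end OverField

/-! ### Counting generating families over a field. -/

section Counting

set_option linter.unusedSectionVars false

variable {ι : Type*} [Fintype ι] [DecidableEq ι] [PartialOrder ι]

variable (ι) in
/-- A pair `i ≤ j` is a diagonal pair, a covering pair, or neither. -/
noncomputable def pairsEquiv :
    ι ⊕ {p : ι × ι // p.1 ⋖ p.2} ⊕ {p : ι × ι // p.1 < p.2 ∧ ¬ p.1 ⋖ p.2} ≃
      {p : ι × ι // p.1 ≤ p.2} :=
  Equiv.ofBijective
    (Sum.elim (fun u => ⟨(u, u), le_rfl⟩)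
      (Sum.elim (fun p => ⟨p.1, p.2.le⟩) fun p => ⟨p.1, p.2.1.le⟩)) <| by
    constructor
    · rintro (u | ⟨p, hp⟩ | ⟨p, hp⟩) (v | ⟨r, hr⟩ | ⟨r, hr⟩) h <;>
        simp only [Sum.elim_inl, Sum.elim_inr, Subtype.mk.injEq] at h <;> subst_vars
      · simpa using h
      · exact absurd hr.lt (lt_irrefl _)
      · exact absurd hr.1 (lt_irrefl _)
      · exact absurd hp.lt (lt_irrefl _)
      · rfl
      · exact absurd hp hr.2
      · exact absurd hp.1 (lt_irrefl _)
      · exact absurd hr hp.2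
      · rfl
    · rintro ⟨⟨u, v⟩, huv⟩
      rcases huv.eq_or_lt with h | h
      · obtain rfl : u = v := h
        exact ⟨Sum.inl u, rfl⟩
      · by_cases hc : u ⋖ v
        · exact ⟨Sum.inr (Sum.inl ⟨(u, v), hc⟩), rfl⟩
        · exact ⟨Sum.inr (Sum.inr ⟨(u, v), h, hc⟩), rfl⟩

variable (ι) in
theorem orderSize_eq : orderSize ι = Fintype.card ι + coverSize ι +
    Nat.card {p : ι × ι // p.1 < p.2 ∧ ¬ p.1 ⋖ p.2} := by
  rw [orderSize, ← Nat.card_congr (pairsEquiv ι), Nat.card_sum, Nat.card_sum, coverSize,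
    Nat.card_eq_fintype_card (α := ι), add_assoc]

variable {κ K : Type*} [Field K]

/-- The vectors outside the line spanned by a nonzero vector. -/
theorem card_ne_smul [Finite K] {V : Type*} [AddCommGroup V] [Module K V] [Finite V] {d : V}
    (hd : d ≠ 0) : Nat.card {b : V // ∀ t : K, b ≠ t • d} = Nat.card V - Nat.card K := by
  have h1 : (Set.range fun t : K => t • d).ncard = Nat.card K := by
    rw [← Set.image_univ, Set.ncard_image_of_injective _ (smul_left_injective K hd),
      Set.ncard_univ]
  have h2 : {b : V | ∀ t : K, b ≠ t • d} = (Set.range fun t : K => t • d)ᶜ := by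
    ext b
    simp [eq_comm]
  change Nat.card {b : V | ∀ t : K, b ≠ t • d} = _
  rw [Nat.card_coe_set_eq, h2, Set.ncard_compl, h1]

variable (ι κ K) in
/-- A generating family over a field consists of distinct diagonal vectors, vectors outside
certain lines at the covering pairs, and arbitrary vectors at the other pairs. -/
noncomputable def genFamiliesEquiv : genFamilies ι κ K ≃
    Σ a : ι ↪ (κ → K),
      ((p : {p : ι × ι // p.1 ⋖ p.2}) → {b : κ → K // ∀ t : K, b ≠ t • (a p.1.1 - a p.1.2)}) ×
        ({p : ι × ι // p.1 < p.2 ∧ ¬ p.1 ⋖ p.2} → κ → K) :=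
  let E : (κ → {p : ι × ι // p.1 ≤ p.2} → K) ≃
      (ι → κ → K) × ({p : ι × ι // p.1 ⋖ p.2} → κ → K) ×
        ({p : ι × ι // p.1 < p.2 ∧ ¬ p.1 ⋖ p.2} → κ → K) :=
    (Equiv.piComm _).trans <| ((pairsEquiv ι).symm.arrowCongr (Equiv.refl _)).trans <|
      (Equiv.sumArrowEquivProdArrow _ _ _).trans <|
        (Equiv.refl _).prodCongr (Equiv.sumArrowEquivProdArrow _ _ _)
  (E.subtypeEquiv (p := (· ∈ genFamilies ι κ K))
    (q := fun x => Function.Injective x.1 ∧ ∀ (p : {p : ι × ι // p.1 ⋖ p.2}) (t : K),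
      x.2.1 p ≠ t • (x.1 p.1.1 - x.1 p.1.2))
    fun _ => mem_genFamilies_field_iff.trans <| and_congr Iff.rfl
      ⟨fun h p => h p.1.1 p.1.2 p.2, fun h u v huv => h ⟨(u, v), huv⟩⟩).trans
  { toFun x := ⟨⟨x.1.1, x.2.1⟩, fun p => ⟨x.1.2.1 p, x.2.2 p⟩, x.1.2.2⟩
    invFun y := ⟨(y.1, fun p => y.2.1 p, y.2.2), y.1.injective, fun p => (y.2.1 p).2⟩
    left_inv _ := rfl
    right_inv _ := rfl }

/-- No existence hypothesis is needed: `descFactorial` vanishes when there are too few vectors for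
an injective diagonal. -/
theorem card_genFamilies_field [Finite K] [Finite κ] :
    Nat.card (genFamilies ι κ K) =
      (Nat.card K ^ Nat.card κ).descFactorial (Fintype.card ι) *
        ((Nat.card K ^ Nat.card κ - Nat.card K) ^ coverSize ι *
          (Nat.card K ^ Nat.card κ) ^ (orderSize ι - Fintype.card ι - coverSize ι)) := by
  classical
  have := Fintype.ofFinite K
  have := Fintype.ofFinite κ
  have hV : Nat.card (κ → K) = Nat.card K ^ Nat.card κ := Nat.card_fun
  rw [Nat.card_congr (genFamiliesEquiv ι κ K), Nat.card_sigma]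
  have hrest : orderSize ι - Fintype.card ι - coverSize ι =
      Nat.card {p : ι × ι // p.1 < p.2 ∧ ¬ p.1 ⋖ p.2} := by
    have := orderSize_eq ι
    omega
  -- Injectivity makes every difference along a cover nonzero, so the count does not depend on `a`.
  have hterm (a : ι ↪ (κ → K)) :
      Nat.card (((p : {p : ι × ι // p.1 ⋖ p.2}) →
        {b : κ → K // ∀ t : K, b ≠ t • (a p.1.1 - a p.1.2)}) ×
          ({p : ι × ι // p.1 < p.2 ∧ ¬ p.1 ⋖ p.2} → κ → K)) =
      (Nat.card K ^ Nat.card κ - Nat.card K) ^ coverSize ι *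
          (Nat.card K ^ Nat.card κ) ^ (orderSize ι - Fintype.card ι - coverSize ι) := by
    rw [Nat.card_prod, Nat.card_pi, hrest, Nat.card_fun, hV, coverSize]
    congr 1
    rw [Finset.prod_congr rfl fun p _ =>
      (card_ne_smul (K := K) (sub_ne_zero.2 (a.injective.ne p.2.lt.ne))), hV]
    simp
  rw [Finset.sum_congr rfl fun a _ => hterm a, Finset.sum_const, Finset.card_univ,
    Fintype.card_embedding_eq, smul_eq_mul, ← hV, Nat.card_eq_fintype_card (α := κ → K)]

/-- The rational form of the count over a field, valid once a generating family exists. -/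
theorem card_genFamilies_field_cast [Finite K] [Finite κ]
    (h : (genFamilies ι κ K).Nonempty) {q s : ℕ}
    (hq : Nat.card K = q) (hs : Nat.card κ = s) :
    Fintype.card ι ≤ q ^ s ∧ (Nat.card (genFamilies ι κ K) : ℚ) =
      ((q ^ s).factorial : ℚ) / ((q ^ s - Fintype.card ι).factorial : ℚ) *
        ((q : ℚ) ^ s - (q : ℚ)) ^ coverSize ι *
        (q : ℚ) ^ (s * (orderSize ι - Fintype.card ι - coverSize ι)) := by
  have hle : Fintype.card ι ≤ q ^ s := by
    obtain ⟨f, hf⟩ := h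
    have := Nat.card_le_card_of_injective _ (mem_genFamilies_field_iff.1 hf).1
    rwa [Nat.card_fun, hq, hs, Nat.card_eq_fintype_card] at this
  refine ⟨hle, ?_⟩
  have hcov : ((q ^ s - q : ℕ) : ℚ) ^ coverSize ι = ((q : ℚ) ^ s - (q : ℚ)) ^ coverSize ι := by
    -- For `s = 0` the subtraction `1 - q` truncates, but then `ι` has at most one element and the
    -- exponent `coverSize ι` is zero.
    rcases Nat.eq_zero_or_pos s with rfl | hs0
    · have hι' : Fintype.card ι ≤ 1 := by simpa using hle
      have := Fintype.card_le_one_iff_subsingleton.1 hι'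
      have hc : coverSize ι = 0 := by
        have : IsEmpty {p : ι × ι // p.1 ⋖ p.2} := ⟨fun p => p.2.lt.ne (Subsingleton.elim _ _)⟩
        exact Nat.card_of_isEmpty
      simp [hc]
    · rw [Nat.cast_sub (Nat.le_self_pow hs0.ne' q), Nat.cast_pow]
  rw [card_genFamilies_field, hq, hs, Nat.cast_mul, Nat.cast_mul, Nat.cast_pow, hcov,
    Nat.descFactorial_eq_div hle, Nat.cast_div (Nat.factorial_dvd_factorial (Nat.sub_le _ _))
      (by exact_mod_cast (Nat.factorial_ne_zero _)), ← pow_mul, Nat.cast_pow, mul_assoc]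

end Counting

/-! ### Assembly of the formula. -/

open scoped Nat in
theorem mainTheorem1 {R : Type*} [Ring R] [Finite R]
    {d : ℕ} (k : Fin d → ℕ) (hk : ∀ i, 1 ≤ k i)
    (F : Fin d → Type*) [∀ i, Field (F i)] [∀ i, Finite (F i)]
    (q : Fin d → ℕ) (hq : ∀ i, Nat.card (F i) = q i)
    (e : (R ⧸ Ring.jacobson R) ≃+* (∀ i, Matrix (Fin (k i)) (Fin (k i)) (F i)))
    {ι : Type*} [Fintype ι] [DecidableEq ι] [PartialOrder ι]
    (n ρ c : ℕ) (hn : Fintype.card ι = n) (hn1 : 1 ≤ n)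
    (hρ : orderSize ι = ρ) (hc : coverSize ι = c)
    (m : ℕ) (hm : mgen ι R ≤ m) :
    -- the two natural-number subtractions in the formula do not truncate
    (∀ i, n ≤ q i ^ (k i ^ 2 * m)) ∧ n + c ≤ ρ ∧
    -- the formula, with `0 ^ 0 = 1`
    ((genTuples ι R m).ncard : ℚ) =
      (Nat.card (Ring.jacobson R) : ℚ) ^ (m * ρ) *
        ∏ i, (((q i ^ (k i ^ 2 * m))! : ℚ) / ((q i ^ (k i ^ 2 * m) - n)! : ℚ) *
          ((q i : ℚ) ^ (k i ^ 2 * m) - (q i : ℚ)) ^ c *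
          (q i : ℚ) ^ (k i ^ 2 * m * (ρ - n - c))) := by
  subst hn hρ hc
  let θ : R →+* ∀ i, Matrix (Fin (k i)) (Fin (k i)) (F i) :=
    (e : _ →+* _).comp (Ideal.Quotient.mk (Ring.jacobson R))
  have hθ : Function.Surjective θ := e.surjective.comp Ideal.Quotient.mk_surjective
  have hker : RingHom.ker θ = Ring.jacobson R := by
    ext x
    exact e.map_eq_zero_iff.trans Ideal.Quotient.eq_zero_iff_mem
  have hμ (i) : Nonempty (Fin (k i)) := ⟨⟨0, hk i⟩⟩
  obtain ⟨A, hA⟩ := genTuples_nonempty_of_le hm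
  -- The hypothesis on `mgen` enters here: a generating tuple over `R` descends to one over each
  -- field.
  have hne (i : Fin d) : (genFamilies ι (Fin m × Fin (k i) × Fin (k i)) (F i)).Nonempty := by
    have hA' := (mem_genTuples_iff A).1 hA
    have h0 : (fun a => (incidenceEquiv ι R).symm (A a)) ∈ genFamilies ι (Fin m) R := by
      intro u v huv
      convert hA' u v huv using 3 with a
      exact congrArg Subtype.val ((incidenceEquiv ι R).apply_symm_apply (A a))
    exact ⟨_, mem_genFamilies_matrix_iff.1 (mem_genFamilies_pi_iff.1 (genFamilies_comp θ hθ h0) i)⟩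
  have hs (i : Fin d) : Nat.card (Fin m × Fin (k i) × Fin (k i)) = k i ^ 2 * m := by
    simp only [Nat.card_prod, Nat.card_fin]
    ring
  have hfield (i : Fin d) := card_genFamilies_field_cast (hne i) (hq i) (hs i)
  refine ⟨fun i => (hfield i).1, by have := orderSize_eq ι; omega, ?_⟩
  rw [ncard_genTuples, card_genFamilies_of_surjective θ hθ hker.le, card_genFamilies_pi, hker,
    Nat.card_fin, Nat.cast_mul, Nat.cast_pow, Nat.cast_prod]
  congr 1
  refine Finset.prod_congr rfl fun i _ => ?_
  rw [card_genFamilies_matrix, (hfield i).2]
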